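/- **Conventions.** Let $\epsilon_{ijk}$ be the Levi-Civita symbol and let $(X_1,X_2,X_3)$ be the basis of $\mathfrak{so}(3)$ with $(X_i)_{jk}=-\epsilon_{ijk}$. For $m\ge 1$ let $(V_m,\rho_m)$ be the irreducible $m$-dimensional complex representation of $\mathfrak{so}(3)$, realized on $\mathbb{C}^m$ by skew-Hermitian matrices (in an orthonormal basis of weight vectors). A *Nahm solution* on a nonempty open interval $I\subseteq\mathbb{R}$ is a triple $\mathcal{T}=(T_1,T_2,T_3):I\to\mathfrak{su}(N)^{\oplus 3}$ with $\dot T_1=[T_2,T_3]$, $\dot T_2=[T_3,T_1]$, $\dot T_3=[T_1,T_2]$. It is *spherically symmetric* if for every $A\in\mathrm{SO}(3)$ there is $U_A\in\mathrm{SU}(N)$ with $U_A\big(\sum_j A_{ij}T_j(t)\big)U_A^{-1}=T_i(t)$ for all $i$ and all $t\in I$. A triple $Y_1,Y_2,Y_3\in\mathfrak{su}(N)$ is a triple of *generators* of the symmetry if $[Y_i,T_j]=\sum_k\epsilon_{ijk}T_k$ on $I$ for all $i,j$. For $m\geq 1$, a triple $B=(B_1,B_2,B_3)$ of linear maps $V_m\to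 V_{m+2}$ is regarded as an element of $V_{m+2}\otimes V_m\otimes V_3$ (using $V_m^*\cong V_m$); it is *invariant* if $\rho_{m+2}(X_j)B_k-B_k\,\rho_m(X_j)=\sum_i\epsilon_{jki}B_i$ for all $j,k$, and has *unit length* if $\sum_i\mathrm{tr}(B_i^*B_i)=1$. **Theorem (Structure theorem for spherically symmetric solutions to Nahm's equations).** Let $\mathcal{T}$ be a spherically symmetric Nahm solution on $I$ with generators $Y_1,Y_2,Y_3$ satisfying $[Y_i,Y_j]=\sum_k\epsilon_{ijk}Y_k$, so that $\rho(X_i)=Y_i$ defines a representation of $\mathfrak{so}(3)$ on $\mathbb{C}^N$. Suppose that $$(\mathbb{C}^N,\rho)\simeq\bigoplus_{a=1}^k (V_{n_a},\rho_{n_a}),\qquad n_a\ge 1,$$ and let $t_0\in I$. Then the following hold. * For every $m\ge 1$, the invariant triples in $V_{m+2}\otimes V_m\otimes V_3$ form a complex line; a unit-length generator $B^m=(B^m_1,B^m_2,B^m_3)$ of it is thus unique up to a factor in $\mathrm{U}(1)$. * There is a unitary isomorphism of representations $Q:(\mathbb{C}^N,\rho)\to\bigoplus_a(V_{n_a},\rho_{n_a})$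 onto the orthogonal direct sum. For every such $Q$, denote by $M_{ab}:V_{n_b}\to V_{n_a}$ the blocks of $QMQ^{-1}$. Then $(T_i(t_0))_{ab}=-(T_i(t_0))_{ba}^*$ and $(T_i(t_0))_{aa}\in\mathfrak{su}(V_{n_a})$ for all $i,a,b$, and there is a gauge transformation $U\in\mathrm{SU}(N)$ (allowed to depend on $t_0$) commuting with $Y_1,Y_2,Y_3$ such that the matrices $T_i:=U\,T_i(t_0)\,U^{-1}$ have these same two properties and satisfy, for all $a,b\in\{1,\dots,k\}$: 1. There is $c_a\in\mathbb{R}$ such that $(T_i)_{aa}=c_a\,\rho_{n_a}(X_i)$ for all $i\in\{1,2,3\}$. 2. If $a\ne b$ and $|n_a-n_b|\ne 2$, then $(T_i)_{ab}=0$ for all $i\in\{1,2,3\}$. 3. If $n_a=n_b+2$, then for every unit-length generator $B^{n_b}$ there is $c_{ab}\in\mathbb{C}$ such that $(T_i)_{ab}=c_{ab}\,B^{n_b}_i$ for all $i\in\{1,2,3\}$. -/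

import Mathlib

namespace Nahm

open Matrix

/-- The Levi-Civita symbol on the indices `0, 1, 2` (arithmetic in `Fin 3` is modulo `3`). -/
def eps (i j k : Fin 3) : ℤ :=
  if j = i + 1 ∧ k = i + 2 then 1 else if j = i + 2 ∧ k = i + 1 then -1 else 0

/-- The standard basis of `𝔰𝔬(3)`: `(X_i)_{jk} = -ε_{ijk}`. -/
def so3Basis (i : Fin 3) : Matrix (Fin 3) (Fin 3) ℝ :=
  Matrix.of fun j k => -(eps i j k : ℝ)

/-- Membership in `𝔰𝔲(ι)`: skew-Hermitian and traceless. -/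
def IsSu {ι : Type*} [Fintype ι] (A : Matrix ι ι ℂ) : Prop :=
  Aᴴ = -A ∧ A.trace = 0

/-- The rotation action on triples, `(ᴬT)_i = ∑_j A_{ij} T_j`, for any real `3 × 3` matrix `A`;
for `A ∈ 𝔰𝔬(3)` it is the induced action of the Lie algebra. -/
def rotate {μ ν : Type*} (A : Matrix (Fin 3) (Fin 3) ℝ) (T : Fin 3 → Matrix μ ν ℂ) :
    Fin 3 → Matrix μ ν ℂ :=
  fun i => ∑ j, (A i j : ℂ) • T j

/-- The gauge action on triples, `(_U T)_i = U T_i U⁻¹`. -/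
noncomputable def gauge {ι : Type*} [Fintype ι] [DecidableEq ι] (U : Matrix.specialUnitaryGroup ι ℂ)
    (T : Fin 3 → Matrix ι ι ℂ) : Fin 3 → Matrix ι ι ℂ :=
  fun i => (U : Matrix ι ι ℂ) * T i * (U : Matrix ι ι ℂ)⁻¹

/-- `T` is an `𝔰𝔲(N)`-valued solution of Nahm's equations on `I`:
`T₁' = [T₂, T₃]`, `T₂' = [T₃, T₁]`, `T₃' = [T₁, T₂]`. -/
def IsNahmSolution {N : ℕ} (I : Set ℝ) (T : ℝ → Fin 3 → Matrix (Fin N) (Fin N) ℂ) : Prop :=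
  (∀ t ∈ I, ∀ i, IsSu (T t i)) ∧
    ∀ t ∈ I, ∀ i, HasDerivAt (fun s => T s i) ⁅T t (i + 1), T t (i + 2)⁆ t

/-- Spherical symmetry: every rotation can be compensated by a constant gauge transformation. -/
def IsSphericallySymmetric {N : ℕ} (I : Set ℝ)
    (T : ℝ → Fin 3 → Matrix (Fin N) (Fin N) ℂ) : Prop :=
  ∀ A ∈ Matrix.specialOrthogonalGroup (Fin 3) ℝ, ∃ U : Matrix.specialUnitaryGroup (Fin N) ℂ,
    ∀ t ∈ I, gauge U (rotate A (T t)) = T t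

/-- `Y` is a triple of generators of the spherical symmetry of `T`:
`Y_i ∈ 𝔰𝔲(N)` and `[Y_i, T_j] = ∑_k ε_{ijk} T_k` on `I`. -/
def IsGenerators {N : ℕ} (I : Set ℝ) (T : ℝ → Fin 3 → Matrix (Fin N) (Fin N) ℂ)
    (Y : Fin 3 → Matrix (Fin N) (Fin N) ℂ) : Prop :=
  (∀ i, IsSu (Y i)) ∧ ∀ t ∈ I, ∀ i j, ⁅Y i, T t j⁆ = ∑ k, eps i j k • T t k

/-- The linear map sending the basis element `X_i` of `𝔰𝔬(3)` to `Y_i` is a representation: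
`[Y_i, Y_j] = ∑_k ε_{ijk} Y_k`. -/
def IsSo3Rep {ι : Type*} [Fintype ι] (Y : Fin 3 → Matrix ι ι ℂ) : Prop :=
  ∀ i j, ⁅Y i, Y j⁆ = ∑ k, eps i j k • Y k

/-- The raising matrix of the `m`-dimensional irreducible representation, in the orthonormal basis
of weight vectors `e_0, …, e_{m-1}`, where `e_p` has weight `(m-1)/2 - p`. -/
noncomputable def raising (m : ℕ) : Matrix (Fin m) (Fin m) ℂ :=
  Matrix.of fun p q =>
    if (q : ℕ) = p + 1 then ((Real.sqrt ((q : ℝ) * ((m : ℝ) - (q : ℝ))) : ℝ) : ℂ) else 0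

/-- The weight matrix `diag((m-1)/2, (m-3)/2, …, -(m-1)/2)`. -/
noncomputable def weight (m : ℕ) : Matrix (Fin m) (Fin m) ℂ :=
  Matrix.diagonal fun p => ((m : ℂ) - 1) / 2 - (p : ℂ)

/-- The irreducible `m`-dimensional representation `(V_m, ρ_m)` of `𝔰𝔬(3)` on `ℂ^m`:
`irrep m i = ρ_m(X_i) = -√-1 J_i`, with `J_i` the Hermitian spin matrices
`J_1 = (J_+ + J_-)/2`, `J_2 = (J_+ - J_-)/(2√-1)`, `J_3` the weight matrix, where `J_+` is the raising
matrix and `J_-` its adjoint. -/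
noncomputable def irrep (m : ℕ) : Fin 3 → Matrix (Fin m) (Fin m) ℂ :=
  ![(-Complex.I / 2) • (raising m + (raising m)ᴴ),
    (-1 / 2 : ℂ) • (raising m - (raising m)ᴴ),
    (-Complex.I) • weight m]

/-- The action of `X_j ∈ 𝔰𝔬(3)` on `Hom(V_n, V_m) ⊗ V_3`, the space of triples of linear maps
`V_n → V_m`; here `V_3` is the complexification of the standard representation `ℝ³`. -/
noncomputable def hatAction {m n : ℕ} (j : Fin 3) (B : Fin 3 → Matrix (Fin m) (Fin n) ℂ) :
    Fin 3 → Matrix (Fin m) (Fin n) ℂ :=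
  rotate (so3Basis j) B + fun k => irrep m j * B k - B k * irrep n j

/-- The subspace of `𝔰𝔬(3)`-invariant elements of `Hom(V_n, V_m) ⊗ V_3 ≅ V_m ⊗ V_n ⊗ V_3`. -/
noncomputable def invariantTriples (m n : ℕ) : Submodule ℂ (Fin 3 → Matrix (Fin m) (Fin n) ℂ) where
  carrier := {B | ∀ j, hatAction j B = 0}
  zero_mem' := by
    intro j
    ext k p q
    simp [hatAction, rotate]
  add_mem' := by
    intro B C hB hC j
    have h : hatAction j (B + C) = hatAction j B + hatAction j C := by
      funext k
      simp only [hatAction, rotate, Pi.add_apply, smul_add, Finset.sum_add_distrib,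
        Matrix.mul_add, Matrix.add_mul]
      abel
    rw [h, hB j, hC j, add_zero]
  smul_mem' := by
    intro c B hB j
    have h : hatAction j (c • B) = c • hatAction j B := by
      funext k
      simp only [hatAction, rotate, Pi.add_apply, Pi.smul_apply, smul_add, Finset.smul_sum,
        Matrix.mul_smul, Matrix.smul_mul, smul_sub, smul_comm c]
    rw [h, hB j, smul_zero]

/-- `B` has unit length in `V_m ⊗ V_n ⊗ V_3`. -/
def IsUnitLength {m n : ℕ} (B : Fin 3 → Matrix (Fin m) (Fin n) ℂ) : Prop :=
  ∑ i, ∑ p, ∑ q, ‖B i p q‖ ^ 2 = 1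

/-- The triple `ρ(X_i) = diag(ρ_{n_1}(X_i), …, ρ_{n_k}(X_i))` on `V_{n_1} ⊕ ⋯ ⊕ V_{n_k}`. -/
noncomputable def sumIrrep {k : ℕ} (n : Fin k → ℕ) (i : Fin 3) :
    Matrix (Σ a, Fin (n a)) (Σ a, Fin (n a)) ℂ :=
  Matrix.blockDiagonal' fun a => irrep (n a) i

/-- `(ℂ^N, ρ)`, with `ρ(X_i) = Y_i`, is isomorphic to `V_{n_1} ⊕ ⋯ ⊕ V_{n_k}`. -/
def IsIsoToSum {N k : ℕ} (Y : Fin 3 → Matrix (Fin N) (Fin N) ℂ) (n : Fin k → ℕ) : Prop :=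
  ∃ (P : Matrix (Σ a, Fin (n a)) (Fin N) ℂ) (R : Matrix (Fin N) (Σ a, Fin (n a)) ℂ),
    P * R = 1 ∧ R * P = 1 ∧ ∀ i, P * Y i = sumIrrep n i * P

/-- `Q` is a unitary isomorphism of representations from `(ℂ^N, ρ)`, with `ρ(X_i) = Y_i`,
to the orthogonal direct sum `V_{n_1} ⊕ ⋯ ⊕ V_{n_k}`. -/
def IsUnitaryIso {N k : ℕ} (Y : Fin 3 → Matrix (Fin N) (Fin N) ℂ) (n : Fin k → ℕ)
    (Q : Matrix (Σ a, Fin (n a)) (Fin N) ℂ) : Prop :=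
  Q * Qᴴ = 1 ∧ Qᴴ * Q = 1 ∧ ∀ i, Q * Y i = sumIrrep n i * Q

/-- The `(a, b)` block `V_{n_b} → V_{n_a}` of the endomorphism `M` of `ℂ^N`, when `ℂ^N` is
identified with `V_{n_1} ⊕ ⋯ ⊕ V_{n_k}` through the unitary matrix `Q`. -/
def block {N k : ℕ} {n : Fin k → ℕ} (Q : Matrix (Σ a, Fin (n a)) (Fin N) ℂ)
    (M : Matrix (Fin N) (Fin N) ℂ) (a b : Fin k) : Matrix (Fin (n a)) (Fin (n b)) ℂ :=
  Matrix.of fun p q => (Q * M * Qᴴ) ⟨a, p⟩ ⟨b, q⟩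

/-- The blocks of the triple satisfy `(T_i)_{ab} = -(T_i)_{ba}^*` and `(T_i)_{aa} ∈ 𝔰𝔲(V_{n_a})`. -/
def HasSuBlocks {N k : ℕ} {n : Fin k → ℕ} (Q : Matrix (Σ a, Fin (n a)) (Fin N) ℂ)
    (T : Fin 3 → Matrix (Fin N) (Fin N) ℂ) : Prop :=
  (∀ i a b, block Q (T i) a b = -(block Q (T i) b a)ᴴ) ∧ ∀ i a, IsSu (block Q (T i) a a)

/-- The gauge transformation `U` is `ρ`-invariant, where `ρ(X_i) = Y_i`. -/
def IsInvariantGauge {N : ℕ} (Y : Fin 3 → Matrix (Fin N) (Fin N) ℂ)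
    (U : Matrix.specialUnitaryGroup (Fin N) ℂ) : Prop :=
  ∀ i, (U : Matrix (Fin N) (Fin N) ℂ) * Y i = Y i * (U : Matrix (Fin N) (Fin N) ℂ)

theorem weight_conjTranspose (m : ℕ) : (weight m)ᴴ = weight m := by
  simp [weight, Matrix.diagonal_conjTranspose, Pi.star_def]

/-- `irrep m` is skew-Hermitian. -/
theorem irrep_conjTranspose (m : ℕ) (i : Fin 3) : (irrep m i)ᴴ = -irrep m i := by
  have hw := weight_conjTranspose m
  fin_cases i
  · simp [irrep, Matrix.conjTranspose_smul, add_comm, neg_div]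
  · simp [irrep, Matrix.conjTranspose_smul, neg_div, ← smul_neg]
  · simp [irrep, Matrix.conjTranspose_smul, hw]

theorem weight_raising (m : ℕ) :
    weight m * raising m - raising m * weight m = raising m := by
  ext p q
  simp only [weight, raising, Matrix.sub_apply, Matrix.diagonal_mul, Matrix.mul_diagonal,
    Matrix.of_apply]
  split_ifs with h
  · have : (q : ℂ) = (p : ℂ) + 1 := by exact_mod_cast congrArg (Nat.cast : ℕ → ℂ) h
    simp only [this]
    ring
  · simp

theorem raising_lowering (m : ℕ) :
    raising m * (raising m)ᴴ - (raising m)ᴴ * raising m = (2 : ℂ) • weight m := by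
  have h1 : raising m * (raising m)ᴴ =
      Matrix.diagonal fun p : Fin m => ((p : ℂ) + 1) * ((m : ℂ) - 1 - p) := by
    ext p r
    simp only [Matrix.mul_apply, Matrix.conjTranspose_apply, raising, Matrix.of_apply,
      Matrix.diagonal_apply]
    by_cases hp : (p : ℕ) + 1 < m
    · rw [Finset.sum_eq_single (⟨p + 1, hp⟩ : Fin m)]
      · by_cases hpr : p = r
        · subst hpr
          have hnn : (0 : ℝ) ≤ ((p : ℕ) + 1 : ℕ) * ((m : ℝ) - ((p : ℕ) + 1 : ℕ)) := by
            have : (((p : ℕ) + 1 : ℕ) : ℝ) ≤ m := by exact_mod_cast hp.le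
            exact mul_nonneg (Nat.cast_nonneg _) (by linarith)
          simp only [if_true, RCLike.star_def, Complex.conj_ofReal]
          rw [← Complex.ofReal_mul, Real.mul_self_sqrt hnn]
          push_cast
          ring
        · have h' : ¬ ((p : ℕ) = r) := fun h => hpr (Fin.ext h)
          simp [hpr, h']
      · intro q _ hq
        have : ¬ ((q : ℕ) = p + 1) := fun h => hq (Fin.ext h)
        simp [this]
      · simp
    · have hpm : (p : ℕ) + 1 = m := by omega
      have hz : ((m : ℂ) - 1 - (p : ℕ)) = 0 := by
        have : ((p : ℕ) : ℂ) + 1 = m := by exact_mod_cast hpm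
        rw [← this]; ring
      rw [Finset.sum_eq_zero]
      · simp [hz]
      · intro q _
        have : ¬ ((q : ℕ) = p + 1) := by omega
        simp [this]
  have h2 : (raising m)ᴴ * raising m =
      Matrix.diagonal fun p : Fin m => (p : ℂ) * ((m : ℂ) - p) := by
    ext p r
    simp only [Matrix.mul_apply, Matrix.conjTranspose_apply, raising, Matrix.of_apply,
      Matrix.diagonal_apply]
    by_cases hp : 0 < (p : ℕ)
    · rw [Finset.sum_eq_single (⟨p - 1, by omega⟩ : Fin m)]
      · have hpp : (p : ℕ) = p - 1 + 1 := by omega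
        by_cases hpr : p = r
        · subst hpr
          have hnn : (0 : ℝ) ≤ (p : ℕ) * ((m : ℝ) - (p : ℕ)) := by
            have : ((p : ℕ) : ℝ) ≤ m := by exact_mod_cast p.2.le
            exact mul_nonneg (Nat.cast_nonneg _) (by linarith)
          simp only [if_pos hpp, if_true, RCLike.star_def, Complex.conj_ofReal]
          rw [← Complex.ofReal_mul, Real.mul_self_sqrt hnn]
          push_cast
          ring
        · have : ¬ ((r : ℕ) = p - 1 + 1) := fun h => hpr (Fin.ext (by omega))
          simp [hpr, this]
      · intro q _ hq
        have : ¬ ((p : ℕ) = q + 1) := fun h => hq (Fin.ext (by simp; omega))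
        simp [this]
      · simp
    · have hz : ((p : ℕ) : ℂ) = 0 := by
        have : (p : ℕ) = 0 := by omega
        simp [this]
      rw [Finset.sum_eq_zero]
      · simp [hz]
      · intro q _
        have : ¬ ((p : ℕ) = q + 1) := by omega
        simp [this]
  rw [h1, h2, weight, Matrix.diagonal_sub, ← Matrix.diagonal_smul]
  congr 1
  funext p
  simp only [Pi.smul_apply, smul_eq_mul]
  ring

/-- `irrep m` is a representation of `𝔰𝔬(3)`. -/
theorem irrep_isSo3Rep (m : ℕ) : IsSo3Rep (irrep m) := by
  have hE := weight_raising m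
  have hEF := raising_lowering m
  have hF : weight m * (raising m)ᴴ - (raising m)ᴴ * weight m = -(raising m)ᴴ := by
    have := congrArg Matrix.conjTranspose hE
    rw [Matrix.conjTranspose_sub, Matrix.conjTranspose_mul, Matrix.conjTranspose_mul,
      weight_conjTranspose] at this
    rw [← neg_sub, this]
  have hI : Complex.I * Complex.I = -1 := Complex.I_mul_I
  have h01 : ⁅irrep m 0, irrep m 1⁆ = irrep m 2 := by
    have : ⁅irrep m 0, irrep m 1⁆ = (-Complex.I / 2) •
        (raising m * (raising m)ᴴ - (raising m)ᴴ * raising m) := by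
      simp only [irrep, Ring.lie_def, Matrix.cons_val_zero, Matrix.cons_val_one,
        Matrix.smul_mul, Matrix.mul_smul, Matrix.add_mul, Matrix.mul_add, Matrix.sub_mul,
        Matrix.mul_sub]
      module
    rw [this, hEF]
    simp only [irrep, Matrix.cons_val]
    module
  have h12 : ⁅irrep m 1, irrep m 2⁆ = irrep m 0 := by
    have : ⁅irrep m 1, irrep m 2⁆ = (-Complex.I / 2) •
        ((weight m * raising m - raising m * weight m) -
          (weight m * (raising m)ᴴ - (raising m)ᴴ * weight m)) := by
      simp only [irrep, Ring.lie_def, Matrix.cons_val,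
        Matrix.smul_mul, Matrix.mul_smul, Matrix.sub_mul, Matrix.mul_sub]
      module
    rw [this, hE, hF]
    simp only [irrep, Matrix.cons_val]
    module
  have h20 : ⁅irrep m 2, irrep m 0⁆ = irrep m 1 := by
    have : ⁅irrep m 2, irrep m 0⁆ = (Complex.I * Complex.I / 2) •
        ((weight m * raising m - raising m * weight m) +
          (weight m * (raising m)ᴴ - (raising m)ᴴ * weight m)) := by
      simp only [irrep, Ring.lie_def, Matrix.cons_val,
        Matrix.smul_mul, Matrix.mul_smul, Matrix.add_mul, Matrix.mul_add]
      module
    rw [this, hE, hF, hI]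
    simp only [irrep, Matrix.cons_val]
    module
  have h10 : ⁅irrep m 1, irrep m 0⁆ = -irrep m 2 := by
    simp only [← h01, Ring.lie_def, neg_sub]
  have h21 : ⁅irrep m 2, irrep m 1⁆ = -irrep m 0 := by
    simp only [← h12, Ring.lie_def, neg_sub]
  have h02 : ⁅irrep m 0, irrep m 2⁆ = -irrep m 1 := by
    simp only [← h20, Ring.lie_def, neg_sub]
  have hs : ∀ i, ⁅irrep m i, irrep m i⁆ = 0 := fun i => by
    simp only [Ring.lie_def, sub_self]
  intro i j
  fin_cases i <;> fin_cases j <;>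
    simp [eps, hs, h01, h12, h20, h10, h21, h02]

/-- `irrep m` is irreducible: it has no invariant subspaces except `0` and the whole space. -/
theorem irrep_irreducible (m : ℕ) (W : Submodule ℂ (Fin m → ℂ))
    (hW : ∀ i, ∀ v ∈ W, irrep m i *ᵥ v ∈ W) : W = ⊥ ∨ W = ⊤ := by
  have hE : ∀ v ∈ W, raising m *ᵥ v ∈ W := by
    intro v hv
    have h := W.sub_mem (W.smul_mem Complex.I (hW 0 v hv)) (hW 1 v hv)
    have e : raising m *ᵥ v = Complex.I • (irrep m 0 *ᵥ v) - irrep m 1 *ᵥ v := by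
      rw [← Matrix.smul_mulVec, ← Matrix.sub_mulVec]
      congr 1
      simp only [irrep, Matrix.cons_val, smul_smul]
      rw [show Complex.I * (-Complex.I / 2) = 1 / 2 by
        rw [mul_div_assoc', mul_neg, Complex.I_mul_I]; norm_num]
      module
    rwa [e]
  have hF : ∀ v ∈ W, (raising m)ᴴ *ᵥ v ∈ W := by
    intro v hv
    have h := W.add_mem (W.smul_mem Complex.I (hW 0 v hv)) (hW 1 v hv)
    have e : (raising m)ᴴ *ᵥ v = Complex.I • (irrep m 0 *ᵥ v) + irrep m 1 *ᵥ v := by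
      rw [← Matrix.smul_mulVec, ← Matrix.add_mulVec]
      congr 1
      simp only [irrep, Matrix.cons_val, smul_smul]
      rw [show Complex.I * (-Complex.I / 2) = 1 / 2 by
        rw [mul_div_assoc', mul_neg, Complex.I_mul_I]; norm_num]
      module
    rwa [e]
  have hne : ∀ q : Fin m, 0 < (q : ℕ) →
      ((Real.sqrt ((q : ℝ) * ((m : ℝ) - (q : ℝ))) : ℝ) : ℂ) ≠ 0 := by
    intro q hq
    have h1 : (0 : ℝ) < (q : ℕ) := by exact_mod_cast hq
    have h2 : ((q : ℕ) : ℝ) < m := by exact_mod_cast q.2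
    exact Complex.ofReal_ne_zero.mpr (Real.sqrt_pos.mpr (mul_pos h1 (by linarith))).ne'
  rcases eq_or_ne W ⊥ with h | h
  · exact Or.inl h
  right
  obtain ⟨v, hv, hv0⟩ := W.exists_mem_ne_zero_of_ne_bot h
  obtain ⟨p₀, -⟩ := Function.ne_iff.mp hv0
  have hm : 0 < m := p₀.pos
  have key : ∀ d : ℕ, ∀ v ∈ W, v ≠ 0 → (∀ q : Fin m, d < (q : ℕ) → v q = 0) →
      Pi.single (⟨0, hm⟩ : Fin m) (1 : ℂ) ∈ W := by
    intro d
    induction d with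
    | zero =>
      intro v hv hv0 hq
      have hv' : v = v ⟨0, hm⟩ • Pi.single (⟨0, hm⟩ : Fin m) (1 : ℂ) := by
        funext q
        by_cases h0 : q = ⟨0, hm⟩
        · subst h0; simp
        · have : 0 < (q : ℕ) := Nat.pos_of_ne_zero fun h => h0 (Fin.ext h)
          simp [hq q this, Pi.single_eq_of_ne h0]
      have hc : v ⟨0, hm⟩ ≠ 0 := by
        intro hc
        rw [hc, zero_smul] at hv'
        exact hv0 hv'
      rw [hv'] at hv
      exact (W.smul_mem_iff hc).mp hv
    | succ d ih =>
      intro v hv hv0 hq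
      by_cases hd : ∃ q : Fin m, (q : ℕ) = d + 1 ∧ v q ≠ 0
      · obtain ⟨q, hqd, hvq⟩ := hd
        refine ih _ (hE v hv) ?_ ?_
        · intro h0
          have := congrFun h0 ⟨d, by omega⟩
          rw [Matrix.mulVec, dotProduct, Finset.sum_eq_single q] at this
          · simp only [raising, Matrix.of_apply, hqd, if_true, Pi.zero_apply] at this
            rw [← hqd] at this
            exact mul_ne_zero (hne q (by omega)) hvq this
          · intro r _ hr
            have : ¬ ((r : ℕ) = d + 1) := fun h => hr (Fin.ext (by omega))
            simp [raising, this]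
          · simp
        · intro p hp
          rw [Matrix.mulVec, dotProduct]
          refine Finset.sum_eq_zero fun r _ => ?_
          by_cases hr : (r : ℕ) = p + 1
          · rw [hq r (by omega), mul_zero]
          · simp [raising, hr]
      · refine ih v hv hv0 fun q hdq => ?_
        by_cases h1 : (q : ℕ) = d + 1
        · by_contra h2
          exact hd ⟨q, h1, h2⟩
        · exact hq q (by omega)
  have h0 := key m v hv hv0 fun q hq => absurd q.2 (by omega)
  have hall : ∀ d : ℕ, ∀ hd : d < m, Pi.single (⟨d, hd⟩ : Fin m) (1 : ℂ) ∈ W := by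
    intro d
    induction d with
    | zero => exact fun _ => h0
    | succ d ih =>
      intro hd
      have h1 := hF _ (ih (by omega))
      have e : (raising m)ᴴ *ᵥ Pi.single (⟨d, by omega⟩ : Fin m) (1 : ℂ) =
          ((Real.sqrt (((d + 1 : ℕ) : ℝ) * ((m : ℝ) - ((d + 1 : ℕ) : ℝ))) : ℝ) : ℂ) •
            Pi.single (⟨d + 1, hd⟩ : Fin m) (1 : ℂ) := by
        funext r
        rw [Matrix.mulVec_single_one]
        by_cases hr : r = ⟨d + 1, hd⟩
        · subst hr
          simp only [raising, Matrix.col_apply, Matrix.conjTranspose_apply, Matrix.of_apply, if_true,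
            RCLike.star_def, Complex.conj_ofReal, Pi.smul_apply, Pi.single_eq_same, smul_eq_mul,
            mul_one]
        · have : ¬ ((r : ℕ) = d + 1) := fun h => hr (Fin.ext h)
          simp [raising, Matrix.conjTranspose_apply, this, Pi.single_eq_of_ne hr]
      rw [e] at h1
      exact (W.smul_mem_iff (hne ⟨d + 1, hd⟩ (Nat.succ_pos d))).mp h1
  rw [eq_top_iff]
  intro w _
  rw [pi_eq_sum_univ' w]
  refine W.sum_mem fun p _ => W.smul_mem _ ?_
  convert hall p p.2 using 1

end Nahm

/-!
Transported by `Q` to `V_{n_1} ⊕ ⋯ ⊕ V_{n_k}`, the relation `[Y_i, T_j] = ∑_k ε_{ijk} T_k` says that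
every block of `T(t₀)`, a triple of linear maps `V_{n_b} → V_{n_a}`, is an invariant triple
(`IsUnitaryIso.block_mem_invariantTriples`). The invariant triples are found by hand, with the ladder
operators on `Hom(V_n, V_m)`. An invariant triple is recovered by lowering from
`B_+ = B_1 + √-1 B_2`, which has weight `1` and commutes with the raising matrices. Such a map is
determined by its highest row, and the weight leaves at most one nonzero entry there
(`eq_zero_of_mem_invariantTriples`). Hence

* there are no nonzero invariants unless `m - n` is `0` or `± 2` (`invariantTriples_eq_zero`);
* for `m = n` they are the multiples of `ρ_m` (`exists_eq_smul_irrep`);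
* for `m = n + 2` with `n ≥ 1` they form a line (`finrank_invariantTriples`); the nonzero invariant
  comes from lowering the explicit highest weight vector `highestHom`.

A unitary `Q` is the unitary factor in the polar decomposition of any isomorphism
(`exists_unitary_intertwiner`).

It remains to remove the blocks between distinct summands of the same dimension. Between such summands
`T(t₀)` is a multiple of `ρ`, and the coefficients may be taken to form a Hermitian matrix on the index
set `{1, …, k}` which only mixes indices of equal dimension. A unitary matrix of the same kind
diagonalizes it and acts on `V_{n_1} ⊕ ⋯ ⊕ V_{n_k}` by an intertwiner
(`exists_unitary_isotypic_diagonal`). Scaled to determinant one, this is the gauge transformation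
(`IsUnitaryIso.exists_gauge`); it commutes with the `Y_i`, so the transformed triple is subject to the
same classification of blocks.
-/

namespace Nahm

open Matrix

/-! ### Ladder operators on `Hom(V_n, V_m)` -/

/-- The action `B ↦ A B - B A'` on `Hom(ℂⁿ, ℂᵐ)` induced by endomorphisms `A` of the target and
`A'` of the source. -/
def homAction {m n : ℕ} (A : Matrix (Fin m) (Fin m) ℂ) (A' : Matrix (Fin n) (Fin n) ℂ) :
    Matrix (Fin m) (Fin n) ℂ →ₗ[ℂ] Matrix (Fin m) (Fin n) ℂ where
  toFun B := A * B - B * A'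
  map_add' B C := by
    simp only [Matrix.mul_add, Matrix.add_mul]
    abel
  map_smul' c B := by
    simp only [Matrix.mul_smul, Matrix.smul_mul, smul_sub, RingHom.id_apply]

theorem homAction_apply {m n : ℕ} (A : Matrix (Fin m) (Fin m) ℂ) (A' : Matrix (Fin n) (Fin n) ℂ)
    (B : Matrix (Fin m) (Fin n) ℂ) : homAction A A' B = A * B - B * A' := rfl

theorem homAction_comm {m n : ℕ} (A C : Matrix (Fin m) (Fin m) ℂ)
    (A' C' : Matrix (Fin n) (Fin n) ℂ) (B : Matrix (Fin m) (Fin n) ℂ) :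
    homAction A A' (homAction C C' B) - homAction C C' (homAction A A' B) =
      homAction (A * C - C * A) (A' * C' - C' * A') B := by
  simp only [homAction_apply, Matrix.mul_sub, Matrix.sub_mul, Matrix.mul_assoc]
  abel

/-- The raising operator on `Hom(V_n, V_m)`. -/
noncomputable def homRaise (m n : ℕ) :
    Matrix (Fin m) (Fin n) ℂ →ₗ[ℂ] Matrix (Fin m) (Fin n) ℂ :=
  homAction (raising m) (raising n)

/-- The lowering operator on `Hom(V_n, V_m)`. -/
noncomputable def homLower (m n : ℕ) :
    Matrix (Fin m) (Fin n) ℂ →ₗ[ℂ] Matrix (Fin m) (Fin n) ℂ :=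
  homAction (raising m)ᴴ (raising n)ᴴ

/-- The weight operator on `Hom(V_n, V_m)`. -/
noncomputable def homWeight (m n : ℕ) :
    Matrix (Fin m) (Fin n) ℂ →ₗ[ℂ] Matrix (Fin m) (Fin n) ℂ :=
  homAction (weight m) (weight n)

theorem weight_lowering (m : ℕ) :
    weight m * (raising m)ᴴ - (raising m)ᴴ * weight m = -(raising m)ᴴ := by
  have := congrArg Matrix.conjTranspose (weight_raising m)
  rw [Matrix.conjTranspose_sub, Matrix.conjTranspose_mul, Matrix.conjTranspose_mul,
    weight_conjTranspose] at this
  rw [← neg_sub, this]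

theorem homWeight_homLower {m n : ℕ} (B : Matrix (Fin m) (Fin n) ℂ) :
    homWeight m n (homLower m n B) = homLower m n (homWeight m n B) - homLower m n B := by
  have h := homAction_comm (weight m) (raising m)ᴴ (weight n) (raising n)ᴴ B
  rw [weight_lowering, weight_lowering] at h
  rw [homWeight, homLower, sub_eq_iff_eq_add.mp h]
  simp only [homAction_apply, Matrix.neg_mul, Matrix.mul_neg]
  abel

theorem homRaise_homLower {m n : ℕ} (B : Matrix (Fin m) (Fin n) ℂ) :
    homRaise m n (homLower m n B) =
      homLower m n (homRaise m n B) + (2 : ℂ) • homWeight m n B := by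
  have h := homAction_comm (raising m) (raising m)ᴴ (raising n) (raising n)ᴴ B
  rw [raising_lowering, raising_lowering] at h
  rw [homRaise, homWeight, homLower, sub_eq_iff_eq_add.mp h]
  simp only [homAction_apply, Matrix.smul_mul, Matrix.mul_smul, smul_sub]
  abel

theorem homAction_irrep_zero {m n : ℕ} (B : Matrix (Fin m) (Fin n) ℂ) :
    homAction (irrep m 0) (irrep n 0) B =
      (-Complex.I / 2) • (homRaise m n B + homLower m n B) := by
  simp only [homRaise, homLower, homAction_apply, irrep, Matrix.cons_val, Matrix.smul_mul,
    Matrix.mul_smul, Matrix.add_mul, Matrix.mul_add]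
  module

theorem homAction_irrep_one {m n : ℕ} (B : Matrix (Fin m) (Fin n) ℂ) :
    homAction (irrep m 1) (irrep n 1) B =
      (-1 / 2 : ℂ) • (homRaise m n B - homLower m n B) := by
  simp only [homRaise, homLower, homAction_apply, irrep, Matrix.cons_val, Matrix.smul_mul,
    Matrix.mul_smul, Matrix.sub_mul, Matrix.mul_sub]
  module

theorem homAction_irrep_two {m n : ℕ} (B : Matrix (Fin m) (Fin n) ℂ) :
    homAction (irrep m 2) (irrep n 2) B = (-Complex.I) • homWeight m n B := by
  simp only [homWeight, homAction_apply, irrep, Matrix.cons_val, Matrix.smul_mul,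
    Matrix.mul_smul]
  module

/-! ### Classification of invariant triples -/

theorem mem_invariantTriples_iff {m n : ℕ} {B : Fin 3 → Matrix (Fin m) (Fin n) ℂ} :
    B ∈ invariantTriples m n ↔
      ∀ j k, irrep m j * B k - B k * irrep n j = ∑ i, eps j k i • B i := by
  change (∀ j, hatAction j B = 0) ↔ _
  refine forall_congr' fun j => ?_
  rw [funext_iff]
  refine forall_congr' fun k => ?_
  have : rotate (so3Basis j) B k = -∑ i, eps j k i • B i := by
    simp only [rotate, so3Basis, Matrix.of_apply, ← Finset.sum_neg_distrib]
    refine Finset.sum_congr rfl fun i _ => ?_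
    rw [← Int.cast_smul_eq_zsmul ℂ, ← neg_smul]
    norm_cast
  rw [hatAction, Pi.add_apply, this, Pi.zero_apply, neg_add_eq_zero, eq_comm]

/-- In terms of `B_± = B_1 ± √-1 B_2` and `B_3`, the ladder relations that an invariant triple
satisfies. -/
theorem ladder_of_mem_invariantTriples {m n : ℕ} {B : Fin 3 → Matrix (Fin m) (Fin n) ℂ}
    (hB : B ∈ invariantTriples m n) :
    homRaise m n (B 0 + Complex.I • B 1) = 0 ∧
    homWeight m n (B 0 + Complex.I • B 1) = B 0 + Complex.I • B 1 ∧
    homLower m n (B 0 + Complex.I • B 1) = (-2 : ℂ) • B 2 ∧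
    homLower m n (B 2) = B 0 - Complex.I • B 1 := by
  have h : ∀ j k, homAction (irrep m j) (irrep n j) (B k) = ∑ i, eps j k i • B i :=
    mem_invariantTriples_iff.mp hB
  have hE : ∀ C, homRaise m n C = Complex.I • homAction (irrep m 0) (irrep n 0) C -
      homAction (irrep m 1) (irrep n 1) C := by
    intro C
    rw [homAction_irrep_zero, homAction_irrep_one, smul_smul, mul_div_assoc', mul_neg,
      Complex.I_mul_I]
    module
  have hF : ∀ C, homLower m n C = Complex.I • homAction (irrep m 0) (irrep n 0) C +
      homAction (irrep m 1) (irrep n 1) C := by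
    intro C
    rw [homAction_irrep_zero, homAction_irrep_one, smul_smul, mul_div_assoc', mul_neg,
      Complex.I_mul_I]
    module
  have hW : ∀ C, homWeight m n C = Complex.I • homAction (irrep m 2) (irrep n 2) C := by
    intro C
    rw [homAction_irrep_two, smul_smul, mul_neg, Complex.I_mul_I, neg_neg, one_smul]
  refine ⟨?_, ?_, ?_, ?_⟩ <;>
    simp only [hE, hF, hW, map_add, map_smul, h, Fin.sum_univ_three] <;>
    simp [eps, smul_smul] <;> module

theorem raising_apply_ne_zero {m : ℕ} {p q : Fin m} (h : (q : ℕ) = p + 1) :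
    raising m p q ≠ 0 := by
  have h1 : (0 : ℝ) < (q : ℕ) := by rw [h]; positivity
  have h2 : ((q : ℕ) : ℝ) < m := by exact_mod_cast q.2
  rw [raising, Matrix.of_apply, if_pos h]
  exact Complex.ofReal_ne_zero.mpr (Real.sqrt_pos.mpr (mul_pos h1 (by linarith))).ne'

/-- A linear map commuting with the raising matrices is determined by its highest row: the raising
matrix transports row `p` to row `p + 1`. -/
theorem eq_zero_of_homRaise_eq_zero {m n : ℕ} {A : Matrix (Fin m) (Fin n) ℂ}
    (hA : homRaise m n A = 0) (h0 : ∀ (p : Fin m) (q : Fin n), (p : ℕ) = 0 → A p q = 0) : A = 0 := by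
  have key : ∀ d : ℕ, ∀ (p : Fin m) (q : Fin n), (p : ℕ) = d → A p q = 0 := by
    intro d
    induction d with
    | zero => exact h0
    | succ d ih =>
      intro p q hp
      have hd : d < m := by omega
      have h := congrFun (congrFun hA ⟨d, hd⟩) q
      rw [homRaise, homAction_apply, Matrix.sub_apply, Matrix.mul_apply, Matrix.mul_apply,
        Finset.sum_eq_single p, Finset.sum_eq_zero, sub_zero] at h
      · exact (mul_eq_zero.mp h).resolve_left (raising_apply_ne_zero hp)
      · intro r _
        rw [ih _ _ rfl, zero_mul]
      · intro r _ hr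
        have : ¬ ((r : ℕ) = d + 1) := fun h => hr (Fin.ext (by omega))
        simp [raising, this]
      · simp
  ext p q
  exact key p p q rfl

theorem weight_eq_of_homWeight {m n : ℕ} {A : Matrix (Fin m) (Fin n) ℂ} {w : ℤ}
    (hA : homWeight m n A = (w : ℂ) • A) {p : Fin m} {q : Fin n} (hpq : A p q ≠ 0) :
    (m : ℤ) - n - 2 * p + 2 * q = 2 * w := by
  have h := congrFun (congrFun hA p) q
  simp only [homWeight, homAction_apply, weight, Matrix.sub_apply, Matrix.diagonal_mul,
    Matrix.mul_diagonal, Matrix.smul_apply, smul_eq_mul] at h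
  have h' := mul_right_cancel₀ hpq ((show _ = _ by linear_combination 2 * h) :
    (((m : ℂ) - n - 2 * p + 2 * q) * A p q = (2 * w) * A p q))
  exact_mod_cast h'

/-- An invariant triple is determined by the highest row of `B_1 + √-1 B_2`, in which only one
entry has the right weight. -/
theorem eq_zero_of_mem_invariantTriples {m n : ℕ} {B : Fin 3 → Matrix (Fin m) (Fin n) ℂ}
    (hB : B ∈ invariantTriples m n)
    (h0 : ∀ (p : Fin m) (q : Fin n), (p : ℕ) = 0 → (m : ℤ) - n + 2 * (q : ℕ) = 2 →
      (B 0 + Complex.I • B 1) p q = 0) :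
    B = 0 := by
  obtain ⟨hE, hW, hF, hF'⟩ := ladder_of_mem_invariantTriples hB
  have hp : B 0 + Complex.I • B 1 = 0 := by
    refine eq_zero_of_homRaise_eq_zero hE fun p q hp => ?_
    by_contra hpq
    have := weight_eq_of_homWeight (w := 1) (by simpa using hW) hpq
    exact hpq (h0 p q hp (by omega))
  have h2 : B 2 = 0 := by
    rw [hp, map_zero, eq_comm, smul_eq_zero] at hF
    exact hF.resolve_left (by norm_num)
  rw [h2, map_zero] at hF'
  have h00 : B 0 = 0 := by
    have : B 0 = (1 / 2 : ℂ) • ((B 0 + Complex.I • B 1) + (B 0 - Complex.I • B 1)) := by module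
    rw [this, hp, ← hF', add_zero, smul_zero]
  have h11 : B 1 = 0 := by
    rw [h00, zero_add, smul_eq_zero] at hp
    exact hp.resolve_left Complex.I_ne_zero
  funext i
  fin_cases i <;> assumption

/-- Taking adjoints exchanges `m` and `n`, since the representations are skew-Hermitian. -/
theorem conjTranspose_mem_invariantTriples {m n : ℕ} {B : Fin 3 → Matrix (Fin m) (Fin n) ℂ}
    (hB : B ∈ invariantTriples m n) : (fun i => (B i)ᴴ) ∈ invariantTriples n m := by
  rw [mem_invariantTriples_iff] at hB ⊢
  intro j k
  have h := congrArg Matrix.conjTranspose (hB j k)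
  rw [Matrix.conjTranspose_sub, Matrix.conjTranspose_mul, Matrix.conjTranspose_mul,
    irrep_conjTranspose, irrep_conjTranspose, Matrix.conjTranspose_sum] at h
  simp only [Matrix.conjTranspose_zsmul] at h
  rw [← h]
  simp only [Matrix.mul_neg, Matrix.neg_mul]
  abel

/-- `V_m ⊗ V_n ⊗ V_3` has no nonzero invariants unless `m - n` is `0` or `± 2`. -/
theorem invariantTriples_eq_zero {m n : ℕ} (h0 : m ≠ n) (h2 : |(m : ℤ) - n| ≠ 2)
    {B : Fin 3 → Matrix (Fin m) (Fin n) ℂ} (hB : B ∈ invariantTriples m n) : B = 0 := by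
  rcases lt_or_gt_of_ne h0 with h | h
  · have hB' := eq_zero_of_mem_invariantTriples (conjTranspose_mem_invariantTriples hB)
      fun p q _ hq => by
        have := abs_of_neg (show (m : ℤ) - n < 0 by omega)
        omega
    funext i
    exact Matrix.conjTranspose_eq_zero.mp (congrFun hB' i)
  · refine eq_zero_of_mem_invariantTriples hB fun p q _ hq => ?_
    have := abs_of_pos (show (0 : ℤ) < (m : ℤ) - n by omega)
    omega

theorem irrep_mem_invariantTriples (m : ℕ) : irrep m ∈ invariantTriples m m :=
  mem_invariantTriples_iff.mpr (irrep_isSo3Rep m)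

/-- For `m ≤ 1` both `B` and `ρ_m` vanish; otherwise the only entry of the right weight in the
highest row is `(0, 1)`, and it is nonzero for `ρ_m`. -/
theorem exists_eq_smul_irrep {m : ℕ} {B : Fin 3 → Matrix (Fin m) (Fin m) ℂ}
    (hB : B ∈ invariantTriples m m) : ∃ c : ℂ, B = c • irrep m := by
  by_cases hm : 1 < m
  · have h0m : 0 < m := by omega
    have he : (irrep m 0 + Complex.I • irrep m 1) ⟨0, h0m⟩ ⟨1, hm⟩ ≠ 0 := by
      have : irrep m 0 + Complex.I • irrep m 1 = (-Complex.I) • raising m := by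
        simp only [irrep, Matrix.cons_val]
        module
      rw [this, Matrix.smul_apply, smul_ne_zero_iff]
      exact ⟨neg_ne_zero.mpr Complex.I_ne_zero, raising_apply_ne_zero rfl⟩
    set c := (B 0 + Complex.I • B 1) ⟨0, h0m⟩ ⟨1, hm⟩ /
      (irrep m 0 + Complex.I • irrep m 1) ⟨0, h0m⟩ ⟨1, hm⟩ with hc
    refine ⟨c, sub_eq_zero.mp (eq_zero_of_mem_invariantTriples
      (sub_mem hB (Submodule.smul_mem _ c (irrep_mem_invariantTriples m))) fun p q hp hq => ?_)⟩
    obtain rfl : p = ⟨0, h0m⟩ := Fin.ext hp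
    obtain rfl : q = ⟨1, hm⟩ := Fin.ext (show (q : ℕ) = 1 by omega)
    have h1 : (B - c • irrep m) 0 + Complex.I • (B - c • irrep m) 1 =
        (B 0 + Complex.I • B 1) - c • (irrep m 0 + Complex.I • irrep m 1) := by
      simp only [Pi.sub_apply, Pi.smul_apply]
      module
    rw [h1, Matrix.sub_apply, Matrix.smul_apply, smul_eq_mul, hc, div_mul_cancel₀ _ he, sub_self]
  · refine ⟨0, ?_⟩
    rw [zero_smul]
    exact eq_zero_of_mem_invariantTriples hB fun p q _ hq => by omega

/-! ### The invariant line in `Hom(V_m, V_{m+2}) ⊗ V_3` -/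

/-- The converse of `ladder_of_mem_invariantTriples`: a vector of weight `1` killed by the raising
operator and by the third power of the lowering operator spans a copy of `V_3`, hence gives an
invariant triple. -/
theorem exists_mem_invariantTriples_of_ladder {m n : ℕ} {x : Matrix (Fin m) (Fin n) ℂ}
    (hE : homRaise m n x = 0) (hW : homWeight m n x = x)
    (hF : homLower m n (homLower m n (homLower m n x)) = 0) :
    ∃ B ∈ invariantTriples m n, B 0 + Complex.I • B 1 = x := by
  -- The normalization for which `x`, `z`, `y` are `B_+`, `B_3`, `B_-`.
  set z := (-1 / 2 : ℂ) • homLower m n x with hz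
  set y := homLower m n z with hy
  have hFx : homLower m n x = (-2 : ℂ) • z := by rw [hz, smul_smul]; norm_num
  have hEz : homRaise m n z = -x := by
    rw [hz, map_smul, homRaise_homLower, hE, hW, map_zero]
    module
  have hWz : homWeight m n z = 0 := by
    rw [hz, map_smul, homWeight_homLower, hW, sub_self, smul_zero]
  have hEy : homRaise m n y = (2 : ℂ) • z := by
    rw [hy, homRaise_homLower, hEz, hWz, map_neg, hFx]
    module
  have hWy : homWeight m n y = -y := by
    rw [hy, homWeight_homLower, hWz, map_zero, zero_sub]
  have hFy : homLower m n y = 0 := by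
    rw [hy, hz, map_smul, map_smul, hF, smul_zero]
  have hFz : homLower m n z = y := rfl
  have hI : Complex.I * Complex.I = -1 := Complex.I_mul_I
  refine ⟨![(1 / 2 : ℂ) • (x + y), (-Complex.I / 2) • (x - y), z], ?_, ?_⟩
  · rw [mem_invariantTriples_iff]
    intro j k
    rw [← homAction_apply]
    clear_value y z
    fin_cases j <;> fin_cases k <;>
      simp only [Fin.zero_eta, Fin.mk_one, Fin.reduceFinMk, homAction_irrep_zero,
        homAction_irrep_one, homAction_irrep_two, Fin.sum_univ_three, Matrix.cons_val, map_smul,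
        map_add, map_sub, hE, hW, hFx, hEz, hWz, hFz, hEy, hWy, hFy] <;>
      simp [eps, smul_smul] <;> match_scalars <;> ring_nf <;> simp <;> ring
  · simp only [Matrix.cons_val, smul_smul, mul_div_assoc', mul_neg, hI]
    module

/-- The highest weight vector, of weight `1`, of the copy of `V_3` in `Hom(V_m, V_{m+2})`. Its entries
`β_p = √((m-p)(m+1-p))` solve the recursion `√(m+1-p) β_{p+1} = √(m-1-p) β_p`, which expresses that it
commutes with the raising matrices. -/
noncomputable def highestHom (m : ℕ) : Matrix (Fin (m + 2)) (Fin m) ℂ :=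
  Matrix.of fun p q =>
    if (p : ℕ) = q then ((Real.sqrt (((m : ℝ) - q) * ((m : ℝ) + 1 - q)) : ℝ) : ℂ) else 0

theorem homWeight_highestHom (m : ℕ) : homWeight (m + 2) m (highestHom m) = highestHom m := by
  ext p q
  simp only [homWeight, homAction_apply, weight, Matrix.sub_apply, Matrix.diagonal_mul,
    Matrix.mul_diagonal, highestHom, Matrix.of_apply]
  split_ifs with h
  · rw [h]
    push_cast
    ring
  · simp

theorem homRaise_highestHom (m : ℕ) : homRaise (m + 2) m (highestHom m) = 0 := by
  ext p q
  rw [homRaise, homAction_apply, Matrix.sub_apply, Matrix.mul_apply, Matrix.mul_apply,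
    Matrix.zero_apply, sub_eq_zero]
  by_cases h : (q : ℕ) = p + 1
  · have hq : ((q : ℕ) : ℝ) < m := by exact_mod_cast q.2
    have hp : ((q : ℕ) : ℝ) = (p : ℕ) + 1 := by exact_mod_cast h
    rw [Finset.sum_eq_single (⟨q, by omega⟩ : Fin (m + 2)),
      Finset.sum_eq_single (⟨p, by omega⟩ : Fin m)]
    · simp only [raising, highestHom, Matrix.of_apply, h, if_true]
      rw [← Complex.ofReal_mul, ← Complex.ofReal_mul, ← Real.sqrt_mul, ← Real.sqrt_mul]
      · congr 2
        push_cast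
        ring
      · exact mul_nonneg (by linarith) (by linarith)
      · refine mul_nonneg (by positivity) ?_
        push_cast
        linarith
    · intro r _ hr
      have : ¬ ((p : ℕ) = r) := fun h => hr (Fin.ext (by simp; omega))
      simp [highestHom, this]
    · simp
    · intro r _ hr
      have : ¬ ((r : ℕ) = q) := fun h => hr (Fin.ext (by simp; omega))
      simp [highestHom, this]
    · simp
  · rw [Finset.sum_eq_zero, Finset.sum_eq_zero] <;> intro r _ <;>
      simp only [raising, highestHom, Matrix.of_apply, mul_ite, ite_mul, zero_mul, mul_zero] <;>
      split_ifs <;> first | rfl | omega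

/-- The third lowering of the highest weight vector is again killed by the raising operator, but
its weight `-2` is not available in the highest row. -/
theorem homLower_homLower_homLower_highestHom (m : ℕ) :
    homLower (m + 2) m (homLower (m + 2) m (homLower (m + 2) m (highestHom m))) = 0 := by
  have hE := homRaise_highestHom m
  have hW := homWeight_highestHom m
  set x := highestHom m
  set f := homLower (m + 2) m with hf
  have hW1 : homWeight (m + 2) m (f x) = 0 := by
    rw [hf, homWeight_homLower, hW, sub_self]
  have hW2 : homWeight (m + 2) m (f (f x)) = -f (f x) := by
    rw [hf, homWeight_homLower, ← hf, hW1, map_zero, zero_sub]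
  have hW3 : homWeight (m + 2) m (f (f (f x))) = ((-2 : ℤ) : ℂ) • f (f (f x)) := by
    rw [hf, homWeight_homLower, ← hf, hW2, map_neg]
    push_cast
    module
  have hE1 : homRaise (m + 2) m (f x) = (2 : ℂ) • x := by
    rw [hf, homRaise_homLower, hE, hW, map_zero, zero_add]
  have hE2 : homRaise (m + 2) m (f (f x)) = (2 : ℂ) • f x := by
    rw [hf, homRaise_homLower, ← hf, hE1, hW1, map_smul, smul_zero, add_zero]
  have hE3 : homRaise (m + 2) m (f (f (f x))) = 0 := by
    rw [hf, homRaise_homLower, ← hf, hE2, hW2, map_smul]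
    module
  refine eq_zero_of_homRaise_eq_zero hE3 fun p q hp => ?_
  by_contra hpq
  have := weight_eq_of_homWeight hW3 hpq
  push_cast at this
  omega

/-- Existence is the highest weight vector `highestHom`; uniqueness holds since the highest row of
`B_1 + √-1 B_2` is concentrated in the entry `(0, 0)`. -/
theorem finrank_invariantTriples {m : ℕ} (hm : 1 ≤ m) :
    Module.finrank ℂ (invariantTriples (m + 2) m) = 1 := by
  obtain ⟨B, hB, hBx⟩ := exists_mem_invariantTriples_of_ladder (homRaise_highestHom m)
    (homWeight_highestHom m) (homLower_homLower_homLower_highestHom m)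
  have hx : (B 0 + Complex.I • B 1) ⟨0, Nat.succ_pos _⟩ ⟨0, hm⟩ ≠ 0 := by
    rw [hBx, highestHom, Matrix.of_apply, if_pos rfl]
    refine Complex.ofReal_ne_zero.mpr (Real.sqrt_pos.mpr ?_).ne'
    have : (0 : ℝ) < m := by exact_mod_cast hm
    simp only [CharP.cast_eq_zero, sub_zero]
    positivity
  refine finrank_eq_one (⟨B, hB⟩ : invariantTriples (m + 2) m) ?_ ?_
  · intro h
    have h0 : B = 0 := congrArg Subtype.val h
    exact hx (by simp [h0])
  · rintro ⟨C, hC⟩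
    set c := (C 0 + Complex.I • C 1) ⟨0, Nat.succ_pos _⟩ ⟨0, hm⟩ /
      (B 0 + Complex.I • B 1) ⟨0, Nat.succ_pos _⟩ ⟨0, hm⟩ with hc
    have h0 : C - c • B = 0 := by
      refine eq_zero_of_mem_invariantTriples (sub_mem hC (Submodule.smul_mem _ c hB))
        fun p q hp hq => ?_
      obtain rfl : p = ⟨0, Nat.succ_pos _⟩ := Fin.ext hp
      obtain rfl : q = ⟨0, hm⟩ := Fin.ext (show (q : ℕ) = 0 by push_cast at hq; omega)
      have h1 : (C - c • B) 0 + Complex.I • (C - c • B) 1 =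
          (C 0 + Complex.I • C 1) - c • (B 0 + Complex.I • B 1) := by
        simp only [Pi.sub_apply, Pi.smul_apply]
        module
      rw [h1, Matrix.sub_apply, Matrix.smul_apply, smul_eq_mul, hc, div_mul_cancel₀ _ hx, sub_self]
    exact ⟨c, Subtype.ext (sub_eq_zero.mp h0).symm⟩

/-! ### Unitary intertwiners -/

open scoped MatrixOrder ComplexOrder in
/-- Isomorphic skew-Hermitian representations are unitarily isomorphic. For an isomorphism `P` with
inverse `R`, the unitary factor `(P Pᴴ)^(-1/2) P = (Rᴴ R)^(1/2) P` of its polar decomposition is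
again an intertwiner, since `Rᴴ R` commutes with the target representation. -/
theorem exists_unitary_intertwiner {μ ν κ : Type*} [Fintype μ] [DecidableEq μ] [Fintype ν]
    [DecidableEq ν] {Y : κ → Matrix ν ν ℂ} {S : κ → Matrix μ μ ℂ} (hY : ∀ i, (Y i)ᴴ = -Y i)
    (hS : ∀ i, (S i)ᴴ = -S i) {P : Matrix μ ν ℂ} {R : Matrix ν μ ℂ} (hPR : P * R = 1)
    (hRP : R * P = 1) (hP : ∀ i, P * Y i = S i * P) :
    ∃ Q : Matrix μ ν ℂ, Q * Qᴴ = 1 ∧ Qᴴ * Q = 1 ∧ ∀ i, Q * Y i = S i * Q := by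
  have hR : ∀ i, Y i * R = R * S i := fun i => by
    calc Y i * R = R * P * Y i * R := by rw [hRP, Matrix.one_mul]
      _ = R * (P * Y i) * R := by rw [Matrix.mul_assoc R]
      _ = R * S i * (P * R) := by rw [hP, ← Matrix.mul_assoc, Matrix.mul_assoc _ P]
      _ = R * S i := by rw [hPR, Matrix.mul_one]
  have hR' : ∀ i, Rᴴ * Y i = S i * Rᴴ := fun i => by
    have := congrArg Matrix.conjTranspose (hR i)
    rw [Matrix.conjTranspose_mul, Matrix.conjTranspose_mul, hY, hS, Matrix.mul_neg,
      Matrix.neg_mul] at this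
    exact neg_injective this
  have hK : (0 : Matrix μ μ ℂ) ≤ Rᴴ * R := (Matrix.posSemidef_conjTranspose_mul_self R).nonneg
  have hcomm : ∀ i, CFC.sqrt (Rᴴ * R) * S i = S i * CFC.sqrt (Rᴴ * R) := fun i => by
    have h : Commute (Rᴴ * R) (S i) := by
      rw [Commute, SemiconjBy, Matrix.mul_assoc, ← hR, ← Matrix.mul_assoc, hR', Matrix.mul_assoc]
    rw [CFC.sqrt_eq_cfc]
    exact h.cfc_nnreal _
  have hH : (CFC.sqrt (Rᴴ * R))ᴴ = CFC.sqrt (Rᴴ * R) :=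
    (CFC.sqrt_nonneg (Rᴴ * R)).isSelfAdjoint
  have hHH : CFC.sqrt (Rᴴ * R) * CFC.sqrt (Rᴴ * R) = Rᴴ * R := CFC.sqrt_mul_sqrt_self _ hK
  set H := CFC.sqrt (Rᴴ * R)
  refine ⟨H * P, ?_, ?_, fun i => ?_⟩
  · have h : H * (H * P * Pᴴ) = 1 := by
      calc H * (H * P * Pᴴ) = H * H * P * Pᴴ := by simp only [Matrix.mul_assoc]
        _ = Rᴴ * (R * P) * Pᴴ := by rw [hHH, Matrix.mul_assoc Rᴴ]
        _ = 1 := by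
          rw [hRP, Matrix.mul_one, ← Matrix.conjTranspose_mul, hPR, Matrix.conjTranspose_one]
    rw [Matrix.conjTranspose_mul, hH, ← Matrix.mul_assoc]
    exact mul_eq_one_comm.mp h
  · calc (H * P)ᴴ * (H * P) = Pᴴ * (H * H) * P := by
          rw [Matrix.conjTranspose_mul, hH]
          simp only [Matrix.mul_assoc]
      _ = (R * P)ᴴ * (R * P) := by
          rw [hHH, Matrix.conjTranspose_mul]
          simp only [Matrix.mul_assoc]
      _ = 1 := by rw [hRP, Matrix.conjTranspose_one, Matrix.one_mul]
  · rw [Matrix.mul_assoc, hP, ← Matrix.mul_assoc, hcomm, Matrix.mul_assoc]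

/-! ### Fibrewise diagonalization of Hermitian matrices -/

/-- The matrix `A` only mixes indices on which `n` takes the same value. -/
def PreservesFibers {ι : Type*} (n : ι → ℕ) (A : Matrix ι ι ℂ) : Prop :=
  ∀ a b, n a ≠ n b → A a b = 0

/-- The diagonal block of `A` on the fibre `n⁻¹(m)`. -/
def fiberBlock {ι : Type*} (n : ι → ℕ) (A : Matrix ι ι ℂ) (m : ℕ) :
    Matrix {a // n a = m} {a // n a = m} ℂ :=
  A.submatrix Subtype.val Subtype.val

theorem PreservesFibers.mul {ι : Type*} [Fintype ι] {n : ι → ℕ} {A B : Matrix ι ι ℂ}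
    (hA : PreservesFibers n A) (hB : PreservesFibers n B) : PreservesFibers n (A * B) := by
  intro a b hab
  rw [Matrix.mul_apply]
  refine Finset.sum_eq_zero fun c _ => ?_
  by_cases h : n a = n c
  · rw [hB c b fun h' => hab (h.trans h'), mul_zero]
  · rw [hA a c h, zero_mul]

theorem PreservesFibers.conjTranspose {ι : Type*} {n : ι → ℕ} {A : Matrix ι ι ℂ}
    (hA : PreservesFibers n A) : PreservesFibers n Aᴴ := by
  intro a b hab
  rw [Matrix.conjTranspose_apply, hA b a hab.symm, star_zero]

theorem preservesFibers_diagonal {ι : Type*} [DecidableEq ι] (n : ι → ℕ) (d : ι → ℂ) :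
    PreservesFibers n (Matrix.diagonal d) :=
  fun _ _ hab => Matrix.diagonal_apply_ne _ fun h => hab (congrArg n h)

theorem PreservesFibers.fiberBlock_mul {ι : Type*} [Fintype ι] {n : ι → ℕ} {A : Matrix ι ι ℂ}
    (hA : PreservesFibers n A) (B : Matrix ι ι ℂ) (m : ℕ) :
    fiberBlock n (A * B) m = fiberBlock n A m * fiberBlock n B m := by
  ext ⟨a, ha⟩ b
  simp only [fiberBlock, Matrix.submatrix_apply, Matrix.mul_apply]
  rw [← Finset.sum_subtype (Finset.univ.filter fun c => n c = m) (by simp)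
    fun c => A a c * B c b, Finset.sum_filter_of_ne]
  intro c _ hc
  by_contra h
  exact hc (by rw [hA a c fun h' => h (h'.symm.trans ha), zero_mul])

theorem PreservesFibers.ext {ι : Type*} {n : ι → ℕ} {A B : Matrix ι ι ℂ}
    (hA : PreservesFibers n A) (hB : PreservesFibers n B)
    (h : ∀ m, fiberBlock n A m = fiberBlock n B m) : A = B := by
  ext a b
  by_cases hab : n a = n b
  · exact congrFun (congrFun (h (n b)) ⟨a, hab⟩) ⟨b, rfl⟩
  · rw [hA a b hab, hB a b hab]

/-- The spectral theorem, applied on each fibre separately so that the diagonalizing unitary preserves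
the fibres. -/
theorem PreservesFibers.exists_unitary_diagonal {ι : Type*} [Fintype ι] [DecidableEq ι]
    {n : ι → ℕ} {C : Matrix ι ι ℂ} (hC : PreservesFibers n C) (hCh : C.IsHermitian) :
    ∃ (W : Matrix ι ι ℂ) (d : ι → ℝ), PreservesFibers n W ∧ W * Wᴴ = 1 ∧
      W * C * Wᴴ = Matrix.diagonal fun a => (d a : ℂ) := by
  have hm : ∀ m, (fiberBlock n C m).IsHermitian := fun m => hCh.submatrix _
  have hspec : ∀ m, ∃ (V : Matrix {a // n a = m} {a // n a = m} ℂ) (e : {a // n a = m} → ℝ),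
      V * Vᴴ = 1 ∧ V * fiberBlock n C m * Vᴴ = Matrix.diagonal fun a => (e a : ℂ) := by
    intro m
    refine ⟨star ((hm m).eigenvectorUnitary : Matrix _ _ ℂ), (hm m).eigenvalues, ?_, ?_⟩
    · rw [← Matrix.star_eq_conjTranspose, star_star]
      exact Unitary.coe_star_mul_self _
    · have := (hm m).conjStarAlgAut_star_eigenvectorUnitary
      rw [Unitary.conjStarAlgAut_star_apply] at this
      rw [← Matrix.star_eq_conjTranspose, star_star, this]
      rfl
  choose V e hV hVe using hspec
  set W : Matrix ι ι ℂ :=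
    Matrix.of fun a b => if h : n b = n a then V (n a) ⟨a, rfl⟩ ⟨b, h⟩ else 0 with hWdef
  have hW : PreservesFibers n W := fun a b hab => by
    rw [hWdef, Matrix.of_apply, dif_neg fun h => hab h.symm]
  have hWm : ∀ m, fiberBlock n W m = V m := by
    intro m
    ext ⟨a, ha⟩ ⟨b, hb⟩
    subst ha
    simp only [fiberBlock, hWdef, Matrix.submatrix_apply, Matrix.of_apply, dif_pos hb]
  have hWm' : ∀ m, fiberBlock n Wᴴ m = (V m)ᴴ := fun m => by
    rw [← hWm]
    rfl
  have hdiag : ∀ (d : ι → ℂ) m, fiberBlock n (Matrix.diagonal d) m =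
      Matrix.diagonal fun a : {a // n a = m} => d a := fun d m =>
    Matrix.submatrix_diagonal _ _ Subtype.val_injective
  refine ⟨W, fun a => e (n a) ⟨a, rfl⟩, hW, ?_, ?_⟩
  · rw [← Matrix.diagonal_one]
    refine (hW.mul hW.conjTranspose).ext (preservesFibers_diagonal _ _) fun m => ?_
    rw [hW.fiberBlock_mul, hWm, hWm', hV, hdiag, ← Matrix.diagonal_one]
  · refine ((hW.mul hC).mul hW.conjTranspose).ext (preservesFibers_diagonal _ _) fun m => ?_
    rw [(hW.mul hC).fiberBlock_mul, hW.fiberBlock_mul, hWm, hWm', hVe, hdiag]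
    congr 1
    funext ⟨a, ha⟩
    subst ha
    rfl

/-! ### Lifting coefficient matrices to `V_{n_1} ⊕ ⋯ ⊕ V_{n_k}` -/

/-- The endomorphism of `V_{n_1} ⊕ ⋯ ⊕ V_{n_k}` whose `(a, b)` block is `A a b` times the identity
of `V_{n_a} = V_{n_b}`; it is meaningful when `A` only mixes equal dimensions. -/
def isotypicLift {k : ℕ} (n : Fin k → ℕ) (A : Matrix (Fin k) (Fin k) ℂ) :
    Matrix (Σ a, Fin (n a)) (Σ a, Fin (n a)) ℂ :=
  Matrix.of fun x y => if (x.2 : ℕ) = y.2 then A x.1 y.1 else 0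

theorem PreservesFibers.isotypicLift_mul {k : ℕ} {n : Fin k → ℕ} {A : Matrix (Fin k) (Fin k) ℂ}
    (hA : PreservesFibers n A) (B : Matrix (Fin k) (Fin k) ℂ) :
    isotypicLift n A * isotypicLift n B = isotypicLift n (A * B) := by
  ext ⟨a, p⟩ ⟨b, q⟩
  simp only [isotypicLift, Matrix.mul_apply, Matrix.of_apply, Fintype.sum_sigma]
  have h : ∀ c, ∑ r : Fin (n c), (if (p : ℕ) = r then A a c else 0) *
      (if (r : ℕ) = q then B c b else 0) = if (p : ℕ) = q then A a c * B c b else 0 := by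
    intro c
    by_cases hac : n a = n c
    · rw [Finset.sum_eq_single (Fin.cast hac p)]
      · simp
      · intro r _ hr
        rw [if_neg fun h => hr (Fin.ext h.symm), zero_mul]
      · simp
    · simp [hA a c hac]
  rw [Finset.sum_congr rfl fun c _ => h c]
  split_ifs <;> simp

theorem isotypicLift_conjTranspose {k : ℕ} (n : Fin k → ℕ) (A : Matrix (Fin k) (Fin k) ℂ) :
    isotypicLift n Aᴴ = (isotypicLift n A)ᴴ := by
  ext x y
  simp only [isotypicLift, Matrix.of_apply, Matrix.conjTranspose_apply, eq_comm, apply_ite star,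
    star_zero]

theorem isotypicLift_one {k : ℕ} (n : Fin k → ℕ) : isotypicLift n 1 = 1 := by
  ext ⟨a, p⟩ ⟨b, q⟩
  rw [isotypicLift, Matrix.of_apply]
  by_cases hab : a = b
  · subst hab
    simp [Matrix.one_apply, Fin.ext_iff]
  · simp [hab]

theorem irrep_congr {m m' : ℕ} (h : m = m') (i : Fin 3) {p q : Fin m} {p' q' : Fin m'}
    (hp : (p : ℕ) = p') (hq : (q : ℕ) = q') : irrep m i p q = irrep m' i p' q' := by
  subst h
  rw [Fin.ext hp, Fin.ext hq]

theorem sumIrrep_mul_apply {k : ℕ} (n : Fin k → ℕ) (i : Fin 3)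
    (X : Matrix (Σ a, Fin (n a)) (Σ a, Fin (n a)) ℂ) (a : Fin k) (p : Fin (n a))
    (y : Σ a, Fin (n a)) :
    (sumIrrep n i * X) ⟨a, p⟩ y = ∑ r, irrep (n a) i p r * X ⟨a, r⟩ y := by
  rw [Matrix.mul_apply, Fintype.sum_sigma, Finset.sum_eq_single a]
  · simp only [sumIrrep, Matrix.blockDiagonal'_apply, dif_pos, cast_eq]
  · intro c _ hc
    refine Finset.sum_eq_zero fun r _ => ?_
    rw [sumIrrep, Matrix.blockDiagonal'_apply_ne _ _ _ hc.symm, zero_mul]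
  · simp

theorem mul_sumIrrep_apply {k : ℕ} (n : Fin k → ℕ) (i : Fin 3)
    (X : Matrix (Σ a, Fin (n a)) (Σ a, Fin (n a)) ℂ) (x : Σ a, Fin (n a)) (b : Fin k)
    (q : Fin (n b)) :
    (X * sumIrrep n i) x ⟨b, q⟩ = ∑ r, X x ⟨b, r⟩ * irrep (n b) i r q := by
  rw [Matrix.mul_apply, Fintype.sum_sigma, Finset.sum_eq_single b]
  · simp only [sumIrrep, Matrix.blockDiagonal'_apply, dif_pos, cast_eq]
  · intro c _ hc
    refine Finset.sum_eq_zero fun r _ => ?_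
    rw [sumIrrep, Matrix.blockDiagonal'_apply_ne _ _ _ hc, mul_zero]
  · simp

theorem sumIrrep_conjTranspose {k : ℕ} (n : Fin k → ℕ) (i : Fin 3) :
    (sumIrrep n i)ᴴ = -sumIrrep n i := by
  rw [sumIrrep, Matrix.blockDiagonal'_conjTranspose, ← Matrix.blockDiagonal'_neg]
  congr 1
  funext a
  exact irrep_conjTranspose _ _

theorem isotypicLift_mul_sumIrrep_apply {k : ℕ} {n : Fin k → ℕ} (A : Matrix (Fin k) (Fin k) ℂ)
    (i : Fin 3) {a b : Fin k} (hab : n a = n b) (p : Fin (n a)) (q : Fin (n b)) :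
    (isotypicLift n A * sumIrrep n i) ⟨a, p⟩ ⟨b, q⟩ = A a b * irrep (n b) i (Fin.cast hab p) q := by
  rw [mul_sumIrrep_apply, Finset.sum_eq_single (Fin.cast hab p)]
  · simp [isotypicLift]
  · intro r _ hr
    have : ¬ ((p : ℕ) = r) := fun h => hr (Fin.ext h.symm)
    simp [isotypicLift, this]
  · simp

/-- The lift of a coefficient matrix that only mixes equal dimensions is an intertwiner. -/
theorem PreservesFibers.isotypicLift_comm {k : ℕ} {n : Fin k → ℕ} {A : Matrix (Fin k) (Fin k) ℂ}
    (hA : PreservesFibers n A) (i : Fin 3) :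
    isotypicLift n A * sumIrrep n i = sumIrrep n i * isotypicLift n A := by
  ext ⟨a, p⟩ ⟨b, q⟩
  by_cases hab : n a = n b
  · rw [isotypicLift_mul_sumIrrep_apply A i hab, sumIrrep_mul_apply,
      Finset.sum_eq_single (Fin.cast hab.symm q)]
    · simp only [isotypicLift, Matrix.of_apply, Fin.val_cast, if_true]
      rw [mul_comm, irrep_congr hab.symm i (p' := p) (q' := Fin.cast hab.symm q) rfl rfl]
    · intro r _ hr
      have : ¬ ((r : ℕ) = q) := fun h => hr (Fin.ext h)
      simp [isotypicLift, this]
    · simp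
  · rw [mul_sumIrrep_apply, sumIrrep_mul_apply, Finset.sum_eq_zero, Finset.sum_eq_zero] <;>
      intro r _ <;> simp [isotypicLift, hA a b hab]

/-! ### Diagonalizing the blocks between summands of equal dimension -/

/-- The endomorphism triple `X` of `V_{n_1} ⊕ ⋯ ⊕ V_{n_k}` is determined, between summands of equal
dimension, by a Hermitian matrix of coefficients. A unitary matrix diagonalizing the coefficients
and mixing only equal dimensions lifts to a unitary intertwiner that brings `X` to the required
form. -/
theorem exists_unitary_isotypic_diagonal {k : ℕ} {n : Fin k → ℕ}
    {X : Fin 3 → Matrix (Σ a, Fin (n a)) (Σ a, Fin (n a)) ℂ} (hX : ∀ i, (X i)ᴴ = -X i)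
    (hinv : ∀ a b, (fun i => Matrix.of fun p q => X i ⟨a, p⟩ ⟨b, q⟩) ∈
      invariantTriples (n a) (n b)) :
    ∃ (V : Matrix (Σ a, Fin (n a)) (Σ a, Fin (n a)) ℂ) (d : Fin k → ℝ), V * Vᴴ = 1 ∧
      (∀ i, V * sumIrrep n i = sumIrrep n i * V) ∧
      ∀ i a b, n a = n b → ∀ p q, (V * X i * Vᴴ) ⟨a, p⟩ ⟨b, q⟩ =
        (d a : ℂ) * sumIrrep n i ⟨a, p⟩ ⟨b, q⟩ := by
  have hcoef : ∀ a b, ∃ c : ℂ, (n a ≠ n b → c = 0) ∧ ∀ hab : n a = n b, ∀ i p q,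
      X i ⟨a, p⟩ ⟨b, q⟩ = c * irrep (n b) i (Fin.cast hab p) q := by
    intro a b
    by_cases hab : n a = n b
    · have key : ∀ m m' (h : m = m') (B : Fin 3 → Matrix (Fin m) (Fin m') ℂ),
          B ∈ invariantTriples m m' →
            ∃ c : ℂ, ∀ i p q, B i p q = c * irrep m' i (Fin.cast h p) q := by
        rintro m _ rfl B hB
        obtain ⟨c, rfl⟩ := exists_eq_smul_irrep hB
        exact ⟨c, fun i p q => rfl⟩
      obtain ⟨c, hc⟩ := key _ _ hab _ (hinv a b)
      exact ⟨c, fun h => absurd hab h, fun _ => hc⟩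
    · exact ⟨0, fun _ => rfl, fun h => absurd h hab⟩
  choose c hc0 hc using hcoef
  -- The coefficients are not unique for one-dimensional summands, where `ρ` vanishes; the
  -- Hermitian part of any choice works because `X` is skew-Hermitian.
  set C : Matrix (Fin k) (Fin k) ℂ := (1 / 2 : ℂ) • (Matrix.of c + (Matrix.of c)ᴴ) with hCdef
  have hCh : C.IsHermitian := by
    rw [Matrix.IsHermitian, hCdef, Matrix.conjTranspose_smul, Matrix.conjTranspose_add,
      Matrix.conjTranspose_conjTranspose, add_comm]
    simp
  have hC : PreservesFibers n C := fun a b hab => by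
    simp [hCdef, hc0 a b hab, hc0 b a hab.symm]
  have hXC : ∀ i a b, n a = n b → ∀ p q,
      X i ⟨a, p⟩ ⟨b, q⟩ = (isotypicLift n C * sumIrrep n i) ⟨a, p⟩ ⟨b, q⟩ := by
    intro i a b hab p q
    have h1 := hc a b hab i p q
    have h2 : X i ⟨a, p⟩ ⟨b, q⟩ = star (c b a) * irrep (n b) i (Fin.cast hab p) q := by
      have e1 := congrFun (congrFun (hX i) ⟨a, p⟩) ⟨b, q⟩
      have e2 := congrFun (congrFun (irrep_conjTranspose (n a) i) p) (Fin.cast hab.symm q)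
      rw [Matrix.conjTranspose_apply, Matrix.neg_apply] at e1 e2
      rw [hc b a hab.symm, star_mul', e2, mul_neg, neg_inj] at e1
      rw [← e1, irrep_congr hab i (p' := Fin.cast hab p) (q' := q) rfl rfl]
    rw [isotypicLift_mul_sumIrrep_apply C i hab, hCdef, Matrix.smul_apply, Matrix.add_apply,
      Matrix.conjTranspose_apply, Matrix.of_apply, Matrix.of_apply, smul_eq_mul]
    linear_combination (1 / 2 : ℂ) * h1 + (1 / 2 : ℂ) * h2
  obtain ⟨W, d, hW, hWW, hWC⟩ := hC.exists_unitary_diagonal hCh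
  refine ⟨isotypicLift n W, d, ?_, hW.isotypicLift_comm, fun i a b hab p q => ?_⟩
  · rw [← isotypicLift_conjTranspose, hW.isotypicLift_mul, hWW, isotypicLift_one]
  · -- Conjugation by the lift of `W` only combines blocks of the same pair of dimensions, and for
    -- equal dimensions `X i` agrees with the lift of `C` times `ρ`.
    have hdiff : (isotypicLift n W * (X i - isotypicLift n C * sumIrrep n i) *
        (isotypicLift n W)ᴴ) ⟨a, p⟩ ⟨b, q⟩ = 0 := by
      rw [Matrix.mul_apply]
      refine Finset.sum_eq_zero fun y _ => ?_
      by_cases hby : n b = n y.1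
      · rw [Matrix.mul_apply, Finset.sum_eq_zero, zero_mul]
        intro x _
        by_cases hax : n a = n x.1
        · rw [Matrix.sub_apply, hXC i x.1 y.1 (hax.symm.trans (hab.trans hby)), sub_self, mul_zero]
        · simp [isotypicLift, hW a x.1 hax]
      · simp [isotypicLift, hW b y.1 hby]
    have hdiag : isotypicLift n W * (isotypicLift n C * sumIrrep n i) * (isotypicLift n W)ᴴ =
        isotypicLift n (Matrix.diagonal fun a => (d a : ℂ)) * sumIrrep n i := by
      rw [← isotypicLift_conjTranspose, ← hWC, ← (hW.mul hC).isotypicLift_mul,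
        ← hW.isotypicLift_mul, Matrix.mul_assoc, Matrix.mul_assoc, Matrix.mul_assoc,
        Matrix.mul_assoc, ← hW.conjTranspose.isotypicLift_comm]
    rw [Matrix.mul_sub, Matrix.sub_mul, Matrix.sub_apply, sub_eq_zero] at hdiff
    rw [hdiff, hdiag, isotypicLift_mul_sumIrrep_apply _ i hab]
    by_cases h : a = b
    · subst h
      simp [sumIrrep, Matrix.blockDiagonal'_apply]
    · simp [sumIrrep, Matrix.blockDiagonal'_apply, h]

/-! ### Blocks and gauge transformations of symmetric triples -/

/-- A unitary matrix can be scaled by a phase into the special unitary group. -/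
theorem exists_smul_mem_specialUnitaryGroup {N : ℕ} {U : Matrix (Fin N) (Fin N) ℂ}
    (hU : U * Uᴴ = 1) : ∃ z : ℂ, z * star z = 1 ∧
      z • U ∈ Matrix.specialUnitaryGroup (Fin N) ℂ := by
  rcases Nat.eq_zero_or_pos N with rfl | hN
  · refine ⟨1, by simp, ?_⟩
    rw [Matrix.mem_specialUnitaryGroup_iff, one_smul]
    exact ⟨Matrix.mem_unitaryGroup_iff.mpr hU, Matrix.det_isEmpty⟩
  · have hd : U.det * star U.det = 1 := by
      rw [← Matrix.det_conjTranspose, ← Matrix.det_mul, hU, Matrix.det_one]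
    obtain ⟨z, hz⟩ := IsAlgClosed.exists_pow_nat_eq (star U.det) hN
    have hzz : z * star z = 1 := by
      have hn : ‖z‖ = 1 := by
        rw [← pow_eq_one_iff_of_nonneg (norm_nonneg z) hN.ne', ← norm_pow, hz, norm_star]
        have := congrArg norm hd
        rw [norm_mul, norm_star, norm_one] at this
        nlinarith [norm_nonneg U.det]
      rw [Complex.star_def, Complex.mul_conj, Complex.normSq_eq_norm_sq, hn]
      simp
    refine ⟨z, hzz, Matrix.mem_specialUnitaryGroup_iff.mpr
      ⟨Matrix.mem_unitaryGroup_iff.mpr ?_, ?_⟩⟩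
    · rw [Matrix.star_eq_conjTranspose, Matrix.conjTranspose_smul, Matrix.smul_mul, Matrix.mul_smul,
        hU, smul_smul, hzz, one_smul]
    · rw [Matrix.det_smul, Fintype.card_fin, hz, mul_comm, hd]

theorem IsUnitaryIso.mul_conjTranspose {N k : ℕ} {Y : Fin 3 → Matrix (Fin N) (Fin N) ℂ}
    {n : Fin k → ℕ} {Q : Matrix (Σ a, Fin (n a)) (Fin N) ℂ} (hQ : IsUnitaryIso Y n Q)
    (i : Fin 3) : Y i * Qᴴ = Qᴴ * sumIrrep n i := by
  obtain ⟨h1, h2, h3⟩ := hQ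
  calc Y i * Qᴴ = Qᴴ * (Q * Y i) * Qᴴ := by rw [← Matrix.mul_assoc, h2, Matrix.one_mul]
    _ = Qᴴ * sumIrrep n i := by
      rw [h3, Matrix.mul_assoc, Matrix.mul_assoc, h1, Matrix.mul_one]

theorem conjTranspose_mul_mul_conjTranspose {μ ν : Type*} [Fintype ν] (Q : Matrix μ ν ℂ)
    {A : Matrix ν ν ℂ} (hA : Aᴴ = -A) : (Q * A * Qᴴ)ᴴ = -(Q * A * Qᴴ) := by
  simp only [Matrix.conjTranspose_mul, Matrix.conjTranspose_conjTranspose, hA,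
    Matrix.neg_mul, Matrix.mul_neg, Matrix.mul_assoc]

/-- Conjugating `[Y_i, T_j] = ∑_l ε_{ijl} T_l` by `Q` and reading off the `(a, b)` block gives the
invariance of that block. -/
theorem IsUnitaryIso.block_mem_invariantTriples {N k : ℕ} {Y : Fin 3 → Matrix (Fin N) (Fin N) ℂ}
    {n : Fin k → ℕ} {Q : Matrix (Σ a, Fin (n a)) (Fin N) ℂ} (hQ : IsUnitaryIso Y n Q)
    {T : Fin 3 → Matrix (Fin N) (Fin N) ℂ}
    (hT : ∀ i j, ⁅Y i, T j⁆ = ∑ l, eps i j l • T l) (a b : Fin k) :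
    (fun i => block Q (T i) a b) ∈ invariantTriples (n a) (n b) := by
  have h4 := hQ.mul_conjTranspose
  have h3 := hQ.2.2
  rw [mem_invariantTriples_iff]
  intro i j
  have h5 : sumIrrep n i * (Q * T j * Qᴴ) - Q * T j * Qᴴ * sumIrrep n i =
      ∑ l, eps i j l • (Q * T l * Qᴴ) := by
    have := congrArg (fun M => Q * M * Qᴴ) (hT i j)
    simp only [Ring.lie_def, Matrix.mul_sub, Matrix.sub_mul, Matrix.mul_sum, Matrix.sum_mul,
      Matrix.mul_smul, Matrix.smul_mul] at this
    rw [← this, Matrix.mul_assoc (Q * T j), ← h4, ← Matrix.mul_assoc (sumIrrep n i),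
      ← Matrix.mul_assoc (sumIrrep n i), ← h3]
    simp only [Matrix.mul_assoc]
  ext p q
  have h6 := congrFun (congrFun h5 ⟨a, p⟩) ⟨b, q⟩
  rw [Matrix.sub_apply, sumIrrep_mul_apply, mul_sumIrrep_apply, Matrix.sum_apply] at h6
  rw [Matrix.sub_apply, Matrix.mul_apply, Matrix.mul_apply, Matrix.sum_apply]
  exact h6

/-- Invariant triples are commutators with `ρ_m`, hence traceless. -/
theorem trace_eq_zero_of_mem_invariantTriples {m : ℕ} {B : Fin 3 → Matrix (Fin m) (Fin m) ℂ}
    (hB : B ∈ invariantTriples m m) (i : Fin 3) : (B i).trace = 0 := by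
  have h := mem_invariantTriples_iff.mp hB (i + 1) (i + 2)
  have e : ∑ l, eps (i + 1) (i + 2) l • B l = B i := by
    fin_cases i <;> simp [eps]
  rw [← e, ← h, Matrix.trace_sub, Matrix.trace_mul_comm, sub_self]

theorem IsUnitaryIso.hasSuBlocks {N k : ℕ} {Y : Fin 3 → Matrix (Fin N) (Fin N) ℂ}
    {n : Fin k → ℕ} {Q : Matrix (Σ a, Fin (n a)) (Fin N) ℂ} (hQ : IsUnitaryIso Y n Q)
    {T : Fin 3 → Matrix (Fin N) (Fin N) ℂ} (hTs : ∀ i, (T i)ᴴ = -T i)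
    (hT : ∀ i j, ⁅Y i, T j⁆ = ∑ l, eps i j l • T l) : HasSuBlocks Q T := by
  have h : ∀ i a b, block Q (T i) a b = -(block Q (T i) b a)ᴴ := by
    intro i a b
    have e : Q * T i * Qᴴ = -(Q * T i * Qᴴ)ᴴ := by
      rw [conjTranspose_mul_mul_conjTranspose Q (hTs i), neg_neg]
    ext p q
    exact congrFun (congrFun e ⟨a, p⟩) ⟨b, q⟩
  exact ⟨h, fun i a => ⟨by rw [eq_comm, neg_eq_iff_eq_neg]; exact h i a a,
    trace_eq_zero_of_mem_invariantTriples (hQ.block_mem_invariantTriples hT a a) i⟩⟩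

theorem gauge_eq {N : ℕ} (U : Matrix.specialUnitaryGroup (Fin N) ℂ)
    (T : Fin 3 → Matrix (Fin N) (Fin N) ℂ) (i : Fin 3) :
    gauge U T i = (U : Matrix (Fin N) (Fin N) ℂ) * T i * (U : Matrix (Fin N) (Fin N) ℂ)ᴴ := by
  rw [gauge, Matrix.inv_eq_right_inv (Matrix.mem_unitaryGroup_iff.mp
    (Matrix.mem_specialUnitaryGroup_iff.mp U.2).1), Matrix.star_eq_conjTranspose]

theorem conjTranspose_gauge {N : ℕ} (U : Matrix.specialUnitaryGroup (Fin N) ℂ)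
    {T : Fin 3 → Matrix (Fin N) (Fin N) ℂ} (hT : ∀ i, (T i)ᴴ = -T i) (i : Fin 3) :
    (gauge U T i)ᴴ = -gauge U T i := by
  rw [gauge_eq, conjTranspose_mul_mul_conjTranspose _ (hT i)]

theorem IsInvariantGauge.lie_gauge {N : ℕ} {Y : Fin 3 → Matrix (Fin N) (Fin N) ℂ}
    {U : Matrix.specialUnitaryGroup (Fin N) ℂ} (hU : IsInvariantGauge Y U)
    {T : Fin 3 → Matrix (Fin N) (Fin N) ℂ}
    (hT : ∀ i j, ⁅Y i, T j⁆ = ∑ l, eps i j l • T l) (i j : Fin 3) :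
    ⁅Y i, gauge U T j⁆ = ∑ l, eps i j l • gauge U T l := by
  have hdet : IsUnit (U : Matrix (Fin N) (Fin N) ℂ).det := by
    rw [(Matrix.mem_specialUnitaryGroup_iff.mp U.2).2]
    exact isUnit_one
  have hU' : Y i * (U : Matrix (Fin N) (Fin N) ℂ)⁻¹ = (U : Matrix (Fin N) (Fin N) ℂ)⁻¹ * Y i := by
    have h := congrArg (fun M => (U : Matrix (Fin N) (Fin N) ℂ)⁻¹ * M *
      (U : Matrix (Fin N) (Fin N) ℂ)⁻¹) (hU i)
    simp only [← Matrix.mul_assoc, Matrix.nonsing_inv_mul _ hdet, Matrix.one_mul] at h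
    rw [h, Matrix.mul_assoc, Matrix.mul_nonsing_inv _ hdet, Matrix.mul_one]
  have h := congrArg (fun M => (U : Matrix (Fin N) (Fin N) ℂ) * M *
    (U : Matrix (Fin N) (Fin N) ℂ)⁻¹) (hT i j)
  simp only [Ring.lie_def, Matrix.mul_sub, Matrix.sub_mul, Matrix.mul_sum, Matrix.sum_mul,
    Matrix.mul_smul, Matrix.smul_mul] at h
  simp only [gauge, Ring.lie_def]
  rw [← h, ← Matrix.mul_assoc (Y i), ← Matrix.mul_assoc (Y i), ← hU i,
    Matrix.mul_assoc _ _ (Y i), ← hU']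
  simp only [Matrix.mul_assoc]

/-- The unitary intertwiner of `exists_unitary_isotypic_diagonal`, pulled back along `Q` and scaled to
determinant one, is a `ρ`-invariant gauge transformation. -/
theorem IsUnitaryIso.exists_gauge {N k : ℕ} {Y : Fin 3 → Matrix (Fin N) (Fin N) ℂ}
    {n : Fin k → ℕ} {Q : Matrix (Σ a, Fin (n a)) (Fin N) ℂ} (hQ : IsUnitaryIso Y n Q)
    {T : Fin 3 → Matrix (Fin N) (Fin N) ℂ} (hTs : ∀ i, (T i)ᴴ = -T i)
    (hT : ∀ i j, ⁅Y i, T j⁆ = ∑ l, eps i j l • T l) :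
    ∃ U : Matrix.specialUnitaryGroup (Fin N) ℂ, IsInvariantGauge Y U ∧
      ∃ d : Fin k → ℝ, ∀ i a b, n a = n b → ∀ p q,
        block Q (gauge U T i) a b p q = (d a : ℂ) * sumIrrep n i ⟨a, p⟩ ⟨b, q⟩ := by
  obtain ⟨V, d, hVV, hV, hd⟩ := exists_unitary_isotypic_diagonal
    (fun i => conjTranspose_mul_mul_conjTranspose Q (hTs i)) fun a b => hQ.block_mem_invariantTriples hT a b
  have h4 := hQ.mul_conjTranspose
  obtain ⟨h1, h2, h3⟩ := hQ
  have hU₀ : Qᴴ * V * Q * (Qᴴ * V * Q)ᴴ = 1 := by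
    calc Qᴴ * V * Q * (Qᴴ * V * Q)ᴴ = Qᴴ * (V * (Q * Qᴴ) * Vᴴ) * Q := by
          simp only [Matrix.conjTranspose_mul, Matrix.conjTranspose_conjTranspose,
            Matrix.mul_assoc]
      _ = 1 := by rw [h1, Matrix.mul_one, hVV, Matrix.mul_one, h2]
  obtain ⟨z, hz, hzU⟩ := exists_smul_mem_specialUnitaryGroup hU₀
  refine ⟨⟨_, hzU⟩, fun i => ?_, d, fun i a b hab p q => ?_⟩
  · have : Qᴴ * V * Q * Y i = Y i * (Qᴴ * V * Q) := by
      rw [Matrix.mul_assoc, h3, ← Matrix.mul_assoc, Matrix.mul_assoc Qᴴ, hV,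
        ← Matrix.mul_assoc, ← h4]
      simp only [Matrix.mul_assoc]
    simp only [Matrix.smul_mul, Matrix.mul_smul, this]
  · rw [← hd i a b hab p q, block, Matrix.of_apply, gauge_eq]
    have : Q * (z • (Qᴴ * V * Q) * T i * (z • (Qᴴ * V * Q))ᴴ) * Qᴴ =
        V * (Q * T i * Qᴴ) * Vᴴ := by
      simp only [Matrix.conjTranspose_smul, Matrix.smul_mul, Matrix.mul_smul, smul_smul]
      rw [mul_comm (star z), hz, one_smul]
      calc Q * (Qᴴ * V * Q * T i * (Qᴴ * V * Q)ᴴ) * Qᴴ =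
            Q * Qᴴ * V * (Q * T i * Qᴴ) * Vᴴ * (Q * Qᴴ) := by
            simp only [Matrix.conjTranspose_mul, Matrix.conjTranspose_conjTranspose,
              Matrix.mul_assoc]
        _ = _ := by rw [h1, Matrix.one_mul, Matrix.mul_one]
    exact congrFun (congrFun this ⟨a, p⟩) ⟨b, q⟩

end Nahm

theorem mainTheorem1 {N : ℕ} (I : Set ℝ) (hIopen : IsOpen I) (hIconn : I.OrdConnected)
    (T : ℝ → Fin 3 → Matrix (Fin N) (Fin N) ℂ) (hT : Nahm.IsNahmSolution I T)
    (hsym : Nahm.IsSphericallySymmetric I T)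
    (Y : Fin 3 → Matrix (Fin N) (Fin N) ℂ) (hgen : Nahm.IsGenerators I T Y)
    (hrep : Nahm.IsSo3Rep Y)
    {k : ℕ} (n : Fin k → ℕ) (hn : ∀ a, 1 ≤ n a) (hdec : Nahm.IsIsoToSum Y n)
    (t₀ : ℝ) (ht₀ : t₀ ∈ I) :
    (∀ m : ℕ, 1 ≤ m → Module.finrank ℂ (Nahm.invariantTriples (m + 2) m) = 1) ∧
    (∃ Q, Nahm.IsUnitaryIso Y n Q) ∧
    ∀ Q, Nahm.IsUnitaryIso Y n Q →
      Nahm.HasSuBlocks Q (T t₀) ∧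
      ∃ U : Matrix.specialUnitaryGroup (Fin N) ℂ, Nahm.IsInvariantGauge Y U ∧
        Nahm.HasSuBlocks Q (Nahm.gauge U (T t₀)) ∧
        (∀ a, ∃ c : ℝ, ∀ i,
          Nahm.block Q (Nahm.gauge U (T t₀) i) a a = (c : ℂ) • Nahm.irrep (n a) i) ∧
        (∀ a b, a ≠ b → |(n a : ℤ) - (n b : ℤ)| ≠ 2 →
          ∀ i, Nahm.block Q (Nahm.gauge U (T t₀) i) a b = 0) ∧
        (∀ a b, n a = n b + 2 →
          ∀ B ∈ Nahm.invariantTriples (n a) (n b), Nahm.IsUnitLength B →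
            ∃ c : ℂ, ∀ i, Nahm.block Q (Nahm.gauge U (T t₀) i) a b = c • B i) := by
  have hTs : ∀ i, (T t₀ i).conjTranspose = -T t₀ i := fun i => (hT.1 t₀ ht₀ i).1
  have hTY := hgen.2 t₀ ht₀
  refine ⟨fun m hm => Nahm.finrank_invariantTriples hm, ?_, fun Q hQ =>
    ⟨hQ.hasSuBlocks hTs hTY, ?_⟩⟩
  · obtain ⟨P, R, hPR, hRP, hP⟩ := hdec
    exact Nahm.exists_unitary_intertwiner (fun i => (hgen.1 i).1) (Nahm.sumIrrep_conjTranspose n)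
      hPR hRP hP
  · obtain ⟨U, hU, d, hd⟩ := hQ.exists_gauge hTs hTY
    have hinv := hQ.block_mem_invariantTriples (hU.lie_gauge hTY)
    refine ⟨U, hU, hQ.hasSuBlocks (Nahm.conjTranspose_gauge U hTs) (hU.lie_gauge hTY),
      fun a => ⟨d a, fun i => ?_⟩, fun a b hab h2 i => ?_, fun a b hab B hB hB1 => ?_⟩
    · ext p q
      rw [hd i a a rfl, Nahm.sumIrrep, Matrix.blockDiagonal'_apply_eq, Matrix.smul_apply,
        smul_eq_mul]
    · by_cases h0 : n a = n b
      · ext p q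
        rw [hd i a b h0, Nahm.sumIrrep, Matrix.blockDiagonal'_apply_ne _ _ _ hab, mul_zero,
          Matrix.zero_apply]
      · exact congrFun (Nahm.invariantTriples_eq_zero h0 h2 (hinv a b)) i
    · have hfin : Module.finrank ℂ (Nahm.invariantTriples (n a) (n b)) = 1 := by
        rw [hab]
        exact Nahm.finrank_invariantTriples (hn b)
      have hB0 : (⟨B, hB⟩ : Nahm.invariantTriples (n a) (n b)) ≠ 0 := by
        intro h
        have h0 : B = 0 := congrArg Subtype.val h
        simp [Nahm.IsUnitLength, h0] at hB1
      obtain ⟨c, hc⟩ := (finrank_eq_one_iff_of_nonzero' _ hB0).mp hfin ⟨_, hinv a b⟩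
      exact ⟨c, fun i => (congrFun (congrArg Subtype.val hc) i).symm⟩
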